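/- Let $d \ge 2$, and let $|\cdot|$ be the Euclidean norm on $\mathbb R^d$. For $E \subseteq \mathbb R^d$ let $\Delta(E) = \{|x-y| : x, y \in E\}$ be its distance set; $E$ has the Steinhaus property if $\Delta(E) \supseteq [0,a)$ for some $a > 0$. For an integer $q \ge 2$ and a real $\sigma > 1$, put $E_0 = [0,1]^d$, $$E_{n+1} = \bigcup_{p \in \{0,\dots,q-1\}^d} \Bigl( \frac pq + q^{-\sigma} E_n \Bigr) \quad (n \ge 0), \qquad E^*[q;\sigma] = \bigcap_{n \ge 1} E_n .$$ There exist $\varepsilon > 0$ and $r > 1$, depending only on $d$, such that the following holds for every real $s \in (d-\varepsilon, d)$. (i) There is a compact, totally disconnected set $K \subseteq \mathbb R^d$ of Hausdorff dimension $s$ that has the Steinhaus property. (ii) Such a set can be built from finitely many copies of a self-similar set: let $\sigma = d/s$, let $q$ be any integer with $q \ge 2$ and $q^\sigma > r$, and let $m$ be the largest integer with $q^\sigma > r^m$. Then there exist $x_0, \dots, x_m \in \mathbb R^d$ and $u_0, \dots, u_m > 0$ such that the sets $x_k + u_k E^*[q;\sigma]$, $0 \le k \le m$, are pairwise disjoint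 and their union $$K^* = \bigsqcup_{k=0}^m \bigl(x_k + u_k E^*[q;\sigma]\bigr)$$ is compact and totally disconnected, has Hausdorff dimension $s$, and has the Steinhaus property. -/

import Mathlib

noncomputable section

/-- The distance set `Δ(E)`: all Euclidean distances `|x - y|` with `x, y ∈ E`. -/
def distanceSet {d : ℕ} (E : Set (EuclideanSpace ℝ (Fin d))) : Set ℝ :=
  {t | ∃ x ∈ E, ∃ y ∈ E, t = dist x y}

/-- The unit cube `[0,1]^d`. -/
def unitCube (d : ℕ) : Set (EuclideanSpace ℝ (Fin d)) :=
  {x | ∀ i, 0 ≤ x i ∧ x i ≤ 1}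

/-- The grid point `p / q`, for `p ∈ {0, …, q - 1}^d`. -/
def gridPoint {d q : ℕ} (p : Fin d → Fin q) : EuclideanSpace ℝ (Fin d) :=
  WithLp.toLp 2 (fun i => ((p i : ℕ) : ℝ) / (q : ℝ))

/-- The affine copy `x + u A` of a set `A`. -/
def affineCopy {d : ℕ} (x : EuclideanSpace ℝ (Fin d)) (u : ℝ)
    (A : Set (EuclideanSpace ℝ (Fin d))) : Set (EuclideanSpace ℝ (Fin d)) :=
  (fun y => x + u • y) '' A

/-- The iterates: stage `0` is `[0,1]^d`, and stage `n + 1` is the union over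
`p ∈ {0, …, q - 1}^d` of the copies `p / q + q ^ (-σ) E_n` of stage `n`.
In particular stage `1` is the union of the cubes `p / q + q ^ (-σ) [0,1]^d`. -/
def falconerStage (d q : ℕ) (σ : ℝ) : ℕ → Set (EuclideanSpace ℝ (Fin d))
  | 0 => unitCube d
  | n + 1 => ⋃ p : Fin d → Fin q,
      affineCopy (gridPoint p) ((q : ℝ) ^ (-σ)) (falconerStage d q σ n)

/-- The self-similar Falconer-type set `E*[q; σ] = ⋂_{n ≥ 1} E_n`. -/
def falconerSet (d q : ℕ) (σ : ℝ) : Set (EuclideanSpace ℝ (Fin d)) :=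
  ⋂ n : ℕ, falconerStage d q σ (n + 1)

/-- The Steinhaus property: `Δ(E)` contains `[0, a)` for some `a > 0`. -/
def HasSteinhausProperty {d : ℕ} (E : Set (EuclideanSpace ℝ (Fin d))) : Prop :=
  ∃ a : ℝ, 0 < a ∧ Set.Ico 0 a ⊆ distanceSet E

end

/-! Put `l = q^(-σ)`, let `C` be the set of sums `∑ (a k / q) l^k` with digits in `{0, …, q - 1}`,
and `D = C - C`, the sums with signed digits of absolute value below `q`. Since `E*` contains `C^d`,
a number `t ≥ 0` is a distance in `E*` once `t² = a² + b²` with `a, b ∈ D`. As `l D ⊆ D`, it is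
enough to reach the radii in `[1/8, 1/2]`: powers of `l` rescale this window, and copies of ratio
`4^(-k)`, `k ≤ m`, fill the gaps between consecutive powers. The window has ratio 4, whence `r = 4`,
and maximality of `m` gives `4^(-(m+1)) ≤ l`.

The window is reached in two regimes. If `l q ≥ 4/5`, rounding shows that `D` itself contains it
(`exists_sq_add_sq_of_ratio_large`). For large `q` the product `l q = q^(1-σ)` may be small and `D`
may have gaps, but two coordinates suffice: when `b` is of order `q^(-1/2)`, moving `b` by `1/q`
changes `a² + b²` only by order `q^(-3/2)`, far below `l` for `σ` near 1. A greedy digit choice then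
converges (`exists_sq_add_sq_of_large`).

The dimension is bounded above by the natural covers and below by a Hölder map onto the cube. Total
disconnectedness holds because `l q < 1` makes every coordinate projection null. -/

/-! ### Cantor digit sums and the product set inside `E*` -/

/-- The sum `∑ (a k / q) l ^ k` attached to a digit sequence `a` and a ratio `l`. -/
noncomputable def cantorSum {q : ℕ} (l : ℝ) (a : ℕ → Fin q) : ℝ :=
  ∑' k, ((a k : ℕ) : ℝ) / q * l ^ k

theorem digit_div_le {q : ℕ} (c : Fin q) : ((c : ℕ) : ℝ) / q ≤ 1 - 1 / q := by
  have hq : (0 : ℝ) < q := by exact_mod_cast Fin.pos c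
  have h : ((c : ℕ) : ℝ) + 1 ≤ q := by exact_mod_cast c.isLt
  rw [div_le_iff₀ hq, sub_mul, one_div_mul_cancel hq.ne']
  linarith

theorem summable_cantorSum {q : ℕ} {l : ℝ} (h0 : 0 ≤ l) (h1 : l < 1) (a : ℕ → Fin q) :
    Summable fun k => ((a k : ℕ) : ℝ) / q * l ^ k := by
  refine Summable.of_nonneg_of_le (fun k => by positivity) (fun k => ?_)
    (summable_geometric_of_lt_one h0 h1)
  have h := digit_div_le (a k)
  have : (0 : ℝ) ≤ 1 / q := by positivity
  exact mul_le_of_le_one_left (by positivity) (by linarith)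

theorem cantorSum_eq_head_add {q : ℕ} {l : ℝ} (h0 : 0 ≤ l) (h1 : l < 1) (a : ℕ → Fin q) :
    cantorSum l a = ((a 0 : ℕ) : ℝ) / q + l * cantorSum l (fun k => a (k + 1)) := by
  unfold cantorSum
  rw [(summable_cantorSum h0 h1 a).tsum_eq_zero_add, ← tsum_mul_left]
  simp only [pow_zero, mul_one, pow_succ]
  congr 1
  exact tsum_congr fun k => by ring

theorem cantorSum_nonneg {q : ℕ} {l : ℝ} (h0 : 0 ≤ l) (a : ℕ → Fin q) : 0 ≤ cantorSum l a :=
  tsum_nonneg fun _ => by positivity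

theorem cantorSum_le_one {q : ℕ} {l : ℝ} (h0 : 0 ≤ l) (h1 : l < 1) (hl : l ≤ 1 / q)
    (a : ℕ → Fin q) : cantorSum l a ≤ 1 := by
  have hs := (summable_geometric_of_lt_one h0 h1).mul_left (1 - 1 / (q : ℝ))
  have : cantorSum l a ≤ ∑' k, (1 - 1 / (q : ℝ)) * l ^ k :=
    (summable_cantorSum h0 h1 a).tsum_le_tsum
      (fun k => mul_le_mul_of_nonneg_right (digit_div_le (a k)) (by positivity)) hs
  rw [tsum_mul_left, tsum_geometric_of_lt_one h0 h1, ← div_eq_mul_inv] at this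
  refine this.trans ((div_le_one (by linarith)).2 (by linarith))

/-- Distinct digits at place `n` separate the sums by at least `l^n / q`; the tails lie in `[0,
l^(n+1)]` and can take back at most `l^(n+1)`. -/
theorem le_abs_cantorSum_sub {q : ℕ} {l : ℝ} (h0 : 0 ≤ l) (h1 : l < 1) (hl : l ≤ 1 / q) (n : ℕ)
    (a b : ℕ → Fin q) (hab : ∀ k < n, a k = b k) (hn : a n ≠ b n) :
    (1 / q - l) * l ^ n ≤ |cantorSum l a - cantorSum l b| := by
  induction n generalizing a b with
  | zero =>
    have hq : (0 : ℝ) < q := by exact_mod_cast Fin.pos (a 0)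
    rw [cantorSum_eq_head_add h0 h1 a, cantorSum_eq_head_add h0 h1 b]
    have ha0 := mul_nonneg h0 (cantorSum_nonneg h0 fun k => a (k + 1))
    have hb0 := mul_nonneg h0 (cantorSum_nonneg h0 fun k => b (k + 1))
    have ha1 := mul_le_of_le_one_right h0 (cantorSum_le_one h0 h1 hl fun k => a (k + 1))
    have hb1 := mul_le_of_le_one_right h0 (cantorSum_le_one h0 h1 hl fun k => b (k + 1))
    rw [pow_zero, mul_one]
    have hne : (a 0 : ℕ) ≠ b 0 := fun h => hn (Fin.ext h)
    have key : ∀ u v : ℕ, u < v → (u : ℝ) / q + 1 / q ≤ v / q := fun u v huv => by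
      rw [← add_div]
      gcongr
      exact_mod_cast huv
    rcases lt_or_gt_of_ne hne with h | h
    · have := key _ _ h
      rw [le_abs]; right; linarith
    · have := key _ _ h
      rw [le_abs]; left; linarith
  | succ n ih =>
    have := ih (fun k => a (k + 1)) (fun k => b (k + 1)) (fun k hk => hab _ (by omega)) hn
    rw [cantorSum_eq_head_add h0 h1 a, cantorSum_eq_head_add h0 h1 b, hab 0 (by omega),
      add_sub_add_left_eq_sub, ← mul_sub, abs_mul, abs_of_nonneg h0]
    calc _ = l * ((1 / q - l) * l ^ n) := by ring
      _ ≤ _ := mul_le_mul_of_nonneg_left this h0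

theorem cantorSum_mem_falconerStage {d q : ℕ} {σ : ℝ} (h1 : (q : ℝ) ^ (-σ) < 1)
    (hl : (q : ℝ) ^ (-σ) ≤ 1 / q) (n : ℕ) (a : Fin d → ℕ → Fin q) :
    WithLp.toLp 2 (fun i => cantorSum ((q : ℝ) ^ (-σ)) (a i)) ∈ falconerStage d q σ n := by
  have h0 : 0 ≤ (q : ℝ) ^ (-σ) := by positivity
  induction n generalizing a with
  | zero => exact fun i => ⟨cantorSum_nonneg h0 _, cantorSum_le_one h0 h1 hl _⟩
  | succ n ih =>
    refine Set.mem_iUnion.2 ⟨fun i => a i 0, _, ih fun i k => a i (k + 1), ?_⟩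
    ext i
    simp only [gridPoint, PiLp.add_apply, PiLp.smul_apply, smul_eq_mul]
    exact (cantorSum_eq_head_add h0 h1 (a i)).symm

theorem cantorSum_mem_falconerSet {d q : ℕ} {σ : ℝ} (h1 : (q : ℝ) ^ (-σ) < 1)
    (hl : (q : ℝ) ^ (-σ) ≤ 1 / q) (a : Fin d → ℕ → Fin q) :
    WithLp.toLp 2 (fun i => cantorSum ((q : ℝ) ^ (-σ)) (a i)) ∈ falconerSet d q σ :=
  Set.mem_iInter.2 fun _ => cantorSum_mem_falconerStage h1 hl _ a

/-! ### Compactness and affine copies -/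

theorem falconerStage_subset_unitCube {d q : ℕ} {σ : ℝ} (hl : (q : ℝ) ^ (-σ) ≤ 1 / q) (n : ℕ) :
    falconerStage d q σ n ⊆ unitCube d := by
  induction n with
  | zero => exact subset_rfl
  | succ n ih =>
    intro x hx
    obtain ⟨p, y, hy, rfl⟩ := Set.mem_iUnion.1 hx
    intro i
    obtain ⟨hy0, hy1⟩ := ih hy i
    have h0 : 0 ≤ (q : ℝ) ^ (-σ) := by positivity
    have hp := digit_div_le (p i)
    simp only [gridPoint, PiLp.add_apply, PiLp.smul_apply, smul_eq_mul]
    refine ⟨by positivity, ?_⟩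
    have := mul_le_of_le_one_right h0 hy1
    linarith

theorem falconerSet_subset_unitCube {d q : ℕ} {σ : ℝ} (hl : (q : ℝ) ^ (-σ) ≤ 1 / q) :
    falconerSet d q σ ⊆ unitCube d :=
  (Set.iInter_subset _ 0).trans (falconerStage_subset_unitCube hl _)

theorem isCompact_unitCube (d : ℕ) : IsCompact (unitCube d) := by
  have h : unitCube d = (EuclideanSpace.equiv (Fin d) ℝ) ⁻¹' Set.Icc 0 1 := by
    ext x
    simp only [unitCube, Set.mem_ofPred_eq, Set.mem_preimage, Set.mem_Icc, Pi.le_def, forall_and]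
    rfl
  rw [h]
  exact (EuclideanSpace.equiv (Fin d) ℝ).toHomeomorph.isCompact_preimage.2 isCompact_Icc

theorem isCompact_affineCopy {d : ℕ} (x : EuclideanSpace ℝ (Fin d)) (u : ℝ)
    {A : Set (EuclideanSpace ℝ (Fin d))} (hA : IsCompact A) : IsCompact (affineCopy x u A) :=
  hA.image (by fun_prop)

theorem isCompact_falconerStage (d q : ℕ) (σ : ℝ) (n : ℕ) : IsCompact (falconerStage d q σ n) := by
  induction n with
  | zero => exact isCompact_unitCube d
  | succ n ih => exact isCompact_iUnion fun p => isCompact_affineCopy _ _ ih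

theorem isCompact_falconerSet (d q : ℕ) (σ : ℝ) : IsCompact (falconerSet d q σ) :=
  (isCompact_falconerStage d q σ 1).of_isClosed_subset
    (isClosed_iInter fun n => (isCompact_falconerStage d q σ (n + 1)).isClosed)
    (Set.iInter_subset _ 0)

theorem dimH_affineCopy {d : ℕ} (x : EuclideanSpace ℝ (Fin d)) {u : ℝ} (hu : u ≠ 0)
    (A : Set (EuclideanSpace ℝ (Fin d))) : dimH (affineCopy x u A) = dimH A := by
  have h : affineCopy x u A = (IsometryEquiv.addLeft x) ''
      ((ContinuousLinearEquiv.smulLeft (Units.mk0 u hu) :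
        EuclideanSpace ℝ (Fin d) ≃L[ℝ] EuclideanSpace ℝ (Fin d)) '' A) := by
    rw [Set.image_image]
    rfl
  rw [h, IsometryEquiv.dimH_image, ContinuousLinearEquiv.dimH_image]

/-! ### Total disconnectedness through null projections -/

open Pointwise in
theorem volume_image_add_mul (c u : ℝ) (A : Set ℝ) :
    MeasureTheory.volume ((fun t => c + u * t) '' A) =
      ENNReal.ofReal |u| * MeasureTheory.volume A := by
  have h : (fun t => c + u * t) '' A = (fun t => c + t) '' (u • A) := by
    rw [← Set.image_smul, Set.image_image]
    rfl
  rw [h, Set.image_add_left, MeasureTheory.measure_preimage_add,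
    MeasureTheory.Measure.addHaar_smul]
  simp

theorem coord_image_affineCopy {d : ℕ} (i : Fin d) (x : EuclideanSpace ℝ (Fin d)) (u : ℝ)
    (A : Set (EuclideanSpace ℝ (Fin d))) :
    (fun y : EuclideanSpace ℝ (Fin d) => y i) '' affineCopy x u A =
      (fun t => x i + u * t) '' ((fun y : EuclideanSpace ℝ (Fin d) => y i) '' A) := by
  simp only [affineCopy, Set.image_image]
  rfl

/-- The `q^d` copies in a stage have only `q` distinct shadows on an axis. -/
theorem volume_coord_image_falconerStage_le {d q : ℕ} {σ : ℝ} (i : Fin d) (n : ℕ) :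
    MeasureTheory.volume ((fun y : EuclideanSpace ℝ (Fin d) => y i) '' falconerStage d q σ n) ≤
      ENNReal.ofReal (q * (q : ℝ) ^ (-σ)) ^ n := by
  induction n with
  | zero =>
    have : (fun y : EuclideanSpace ℝ (Fin d) => y i) '' falconerStage d q σ 0 ⊆ Set.Icc 0 1 := by
      rintro _ ⟨y, hy, rfl⟩
      exact hy i
    simpa using MeasureTheory.measure_mono (μ := MeasureTheory.volume) this
  | succ n ih =>
    set A : Set ℝ := (fun y : EuclideanSpace ℝ (Fin d) => y i) '' falconerStage d q σ n
    have h0 : 0 ≤ (q : ℝ) ^ (-σ) := by positivity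
    have hsub : (fun y : EuclideanSpace ℝ (Fin d) => y i) '' falconerStage d q σ (n + 1) ⊆
        ⋃ c : Fin q, (fun t => ((c : ℕ) : ℝ) / q + (q : ℝ) ^ (-σ) * t) '' A := by
      rw [falconerStage, Set.image_iUnion]
      refine Set.iUnion_subset fun p => ?_
      rw [coord_image_affineCopy]
      exact Set.subset_iUnion (fun c : Fin q =>
        (fun t => ((c : ℕ) : ℝ) / q + (q : ℝ) ^ (-σ) * t) '' A) (p i)
    refine (MeasureTheory.measure_mono hsub).trans
      ((MeasureTheory.measure_iUnion_fintype_le _ _).trans ?_)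
    simp only [volume_image_add_mul, Finset.sum_const, Finset.card_univ, Fintype.card_fin,
      nsmul_eq_mul, abs_of_nonneg h0]
    rw [← mul_assoc, pow_succ', ENNReal.ofReal_mul (by positivity), ENNReal.ofReal_natCast] at *
    gcongr

theorem volume_coord_image_falconerSet {d q : ℕ} {σ : ℝ} (hl : q * (q : ℝ) ^ (-σ) < 1)
    (i : Fin d) :
    MeasureTheory.volume ((fun y : EuclideanSpace ℝ (Fin d) => y i) '' falconerSet d q σ) = 0 := by
  have hlim : Filter.Tendsto (fun n : ℕ => ENNReal.ofReal (q * (q : ℝ) ^ (-σ)) ^ (n + 1))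
      Filter.atTop (nhds 0) :=
    (Filter.tendsto_add_atTop_iff_nat 1).2
      (ENNReal.tendsto_pow_atTop_nhds_zero_of_lt_one (ENNReal.ofReal_lt_one.2 hl))
  refine le_antisymm (ge_of_tendsto' hlim fun n => ?_) zero_le
  exact (MeasureTheory.measure_mono (Set.image_mono (Set.iInter_subset _ n))).trans
    (volume_coord_image_falconerStage_le i (n + 1))

/-- A connected subset projects onto intervals, and a null interval has at most one point. -/
theorem isTotallyDisconnected_of_volume_coord_image {d : ℕ} {K : Set (EuclideanSpace ℝ (Fin d))}
    (hK : ∀ i, MeasureTheory.volume ((fun y : EuclideanSpace ℝ (Fin d) => y i) '' K) = 0) :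
    IsTotallyDisconnected K := by
  intro S hSK hS x hx y hy
  ext i
  have hP : IsPreconnected ((fun y : EuclideanSpace ℝ (Fin d) => y i) '' S) :=
    hS.image _ (by fun_prop)
  have hnull := MeasureTheory.measure_mono_null (Set.image_mono hSK) (hK i)
  have key : ∀ z ∈ S, ∀ w ∈ S, ¬ z i < w i := by
    intro z hz w hw hlt
    have := MeasureTheory.measure_mono_null
      (hP.Icc_subset (Set.mem_image_of_mem _ hz) (Set.mem_image_of_mem _ hw)) hnull
    rw [Real.volume_Icc, ENNReal.ofReal_eq_zero] at this
    linarith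
  exact le_antisymm (not_lt.1 (key y hy x hx)) (not_lt.1 (key x hx y hy))

theorem isTotallyDisconnected_iUnion_affineCopy {ι : Type*} [Countable ι] {d q : ℕ} {σ : ℝ}
    (hl : q * (q : ℝ) ^ (-σ) < 1) (x : ι → EuclideanSpace ℝ (Fin d)) (u : ι → ℝ) :
    IsTotallyDisconnected (⋃ k, affineCopy (x k) (u k) (falconerSet d q σ)) := by
  refine isTotallyDisconnected_of_volume_coord_image fun i => ?_
  rw [Set.image_iUnion, MeasureTheory.measure_iUnion_null_iff]
  intro k
  rw [coord_image_affineCopy, volume_image_add_mul, volume_coord_image_falconerSet hl, mul_zero]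

/-! ### Signed digits and reduction to sums of two squares -/

/-- The sums `∑ (b k / q) l ^ k` over integer digits with `|b k| < q`. -/
def signedDigitSums (q : ℕ) (l : ℝ) : Set ℝ :=
  {x | ∃ b : ℕ → ℤ, (∀ k, |b k| < q) ∧ HasSum (fun k => (b k : ℝ) / q * l ^ k) x}

theorem zero_mem_signedDigitSums {q : ℕ} (hq : 0 < q) (l : ℝ) : 0 ∈ signedDigitSums q l :=
  ⟨fun _ => 0, fun _ => by simpa using hq, by simp⟩

theorem mul_mem_signedDigitSums {q : ℕ} {l x : ℝ} (hx : x ∈ signedDigitSums q l) :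
    l * x ∈ signedDigitSums q l := by
  obtain ⟨b, hb, hs⟩ := hx
  -- Multiplication by `l` prepends the digit 0.
  refine ⟨fun k => k.casesOn 0 b, fun k => ?_, ?_⟩
  · cases k with
    | zero => simpa using (abs_nonneg _).trans_lt (hb 0)
    | succ k => exact hb k
  · rw [← hasSum_nat_add_iff' 1]
    simpa [pow_succ, mul_comm, mul_left_comm, mul_assoc] using hs.mul_left l

theorem exists_eq_cantorSum_sub {q : ℕ} {l x : ℝ} (h0 : 0 ≤ l) (h1 : l < 1)
    (hx : x ∈ signedDigitSums q l) :
    ∃ a a' : ℕ → Fin q, x = cantorSum l a - cantorSum l a' := by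
  obtain ⟨b, hb, hs⟩ := hx
  -- Each signed digit is split into its positive and negative parts.
  have hb' : ∀ k, (b k).toNat < q ∧ (-b k).toNat < q := fun k => by
    have := abs_lt.1 (hb k)
    omega
  refine ⟨fun k => ⟨(b k).toNat, (hb' k).1⟩, fun k => ⟨(-b k).toNat, (hb' k).2⟩, ?_⟩
  have h := (summable_cantorSum h0 h1 fun k => (⟨(b k).toNat, (hb' k).1⟩ : Fin q)).hasSum.sub
    (summable_cantorSum h0 h1 fun k => (⟨(-b k).toNat, (hb' k).2⟩ : Fin q)).hasSum
  refine hs.unique (h.congr_fun fun k => ?_)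
  have : ((b k).toNat : ℤ) - ((-b k).toNat : ℤ) = b k := by omega
  rw [← sub_mul, ← sub_div]
  congr 2
  exact_mod_cast this.symm

theorem mem_distanceSet_falconerSet {d q : ℕ} {σ t a b : ℝ} (hd : 2 ≤ d) (hq : 0 < q)
    (h1 : (q : ℝ) ^ (-σ) < 1) (hl : (q : ℝ) ^ (-σ) ≤ 1 / q) (ht : 0 ≤ t)
    (ha : a ∈ signedDigitSums q ((q : ℝ) ^ (-σ))) (hb : b ∈ signedDigitSums q ((q : ℝ) ^ (-σ)))
    (hab : a ^ 2 + b ^ 2 = t ^ 2) : t ∈ distanceSet (falconerSet d q σ) := by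
  obtain ⟨e, rfl⟩ := Nat.exists_eq_add_of_le' hd
  set v : Fin (e + 2) → ℝ := Fin.cons a (Fin.cons b 0) with hv
  have hvD : ∀ i, v i ∈ signedDigitSums q ((q : ℝ) ^ (-σ)) := by
    intro i
    refine Fin.cases ha (fun j => ?_) i
    exact Fin.cases hb (fun k => zero_mem_signedDigitSums hq _) j
  choose x y hxy using fun i => exists_eq_cantorSum_sub (by positivity) h1 (hvD i)
  refine ⟨_, cantorSum_mem_falconerSet h1 hl x, _, cantorSum_mem_falconerSet h1 hl y, ?_⟩
  simp only [EuclideanSpace.dist_eq, Real.dist_eq, ← hxy, sq_abs]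
  simp only [hv, Fin.sum_univ_succ, Fin.cons_zero, Fin.cons_succ, Pi.zero_apply]
  simp [hab, Real.sqrt_sq ht]

/-- Common engine of both regimes: `P` is an invariant of the partial sums that admissible digits
preserve, and it forces the error in `t²` to tend to 0. -/
theorem exists_signedDigitSums_sq_add_sq {q : ℕ} {l t : ℝ} (h0 : 0 ≤ l) (h1 : l < 1)
    (P : ℕ → ℝ → ℝ → Prop) (hP0 : P 0 0 0)
    (hstep : ∀ n X Y, P n X Y → ∃ z w : ℤ, |z| < q ∧ |w| < q ∧
      P (n + 1) (X + z / q * l ^ n) (Y + w / q * l ^ n))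
    (hP : ∀ n X Y, P n X Y → |X ^ 2 + Y ^ 2 - t ^ 2| ≤ 2 * l ^ n) :
    ∃ a ∈ signedDigitSums q l, ∃ b ∈ signedDigitSums q l, a ^ 2 + b ^ 2 = t ^ 2 := by
  choose! z w hz hw hzw using hstep
  let F : ℕ → ℝ × ℝ := fun n => n.rec (0, 0) fun n p =>
    (p.1 + z n p.1 p.2 / q * l ^ n, p.2 + w n p.1 p.2 / q * l ^ n)
  have hF : ∀ n, P n (F n).1 (F n).2 := fun n => by
    induction n with
    | zero => exact hP0
    | succ n ih => exact hzw n _ _ ih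
  have hsum : ∀ b : ℕ → ℤ, (∀ k, |b k| < q) → Summable fun k => (b k : ℝ) / q * l ^ k := by
    intro b hb
    refine Summable.of_norm_bounded (summable_geometric_of_lt_one h0 h1) fun k => ?_
    rw [norm_mul, norm_div, norm_pow, Real.norm_of_nonneg h0, RCLike.norm_natCast,
      Real.norm_eq_abs]
    refine mul_le_of_le_one_left (by positivity) (div_le_one_of_le₀ ?_ (by positivity))
    exact_mod_cast (hb k).le
  have hsX := (hsum (fun k => z k (F k).1 (F k).2) fun k => hz k _ _ (hF k)).hasSum
  have hsY := (hsum (fun k => w k (F k).1 (F k).2) fun k => hw k _ _ (hF k)).hasSum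
  refine ⟨_, ⟨_, fun k => hz k _ _ (hF k), hsX⟩, _, ⟨_, fun k => hw k _ _ (hF k), hsY⟩, ?_⟩
  have hX : ∀ n, ∑ k ∈ Finset.range n, (z k (F k).1 (F k).2 : ℝ) / q * l ^ k = (F n).1 := by
    intro n
    induction n with
    | zero => simp [F]
    | succ n ih => rw [Finset.sum_range_succ, ih]
  have hY : ∀ n, ∑ k ∈ Finset.range n, (w k (F k).1 (F k).2 : ℝ) / q * l ^ k = (F n).2 := by
    intro n
    induction n with
    | zero => simp [F]
    | succ n ih => rw [Finset.sum_range_succ, ih]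
  have htX := hsX.tendsto_sum_nat
  have htY := hsY.tendsto_sum_nat
  simp only [hX] at htX
  simp only [hY] at htY
  have hlim := (((htX.pow 2).add (htY.pow 2)).sub_const (t ^ 2)).abs
  have hz0 : Filter.Tendsto (fun n : ℕ => 2 * l ^ n) Filter.atTop (nhds 0) := by
    simpa using (tendsto_pow_atTop_nhds_zero_of_lt_one h0 h1).const_mul 2
  have := le_of_tendsto_of_tendsto' hlim hz0 fun n => hP n _ _ (hF n)
  linarith [abs_nonpos_iff.1 this]

/-! ### Reaching the window of radii: one coordinate, then two -/

/-- One coordinate is enough: rounding `q τ` leaves an error of at most `1 / (2q)`, which is at most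
`5/8 l` because `l q ≥ 4/5`. -/
theorem exists_sq_add_sq_of_ratio_large {q : ℕ} {l t : ℝ} (hq : 4 ≤ q) (h0 : 0 < l) (h1 : l < 1)
    (hl : 4 / 5 ≤ l * q) (ht0 : 0 ≤ t) (ht1 : t ≤ 1 / 2) :
    ∃ a ∈ signedDigitSums q l, ∃ b ∈ signedDigitSums q l, a ^ 2 + b ^ 2 = t ^ 2 := by
  have hq' : (4 : ℝ) ≤ q := by exact_mod_cast hq
  refine exists_signedDigitSums_sq_add_sq h0.le h1
    (fun n X Y => Y = 0 ∧ |t - X| ≤ 5 / 8 * l ^ n) ⟨rfl, ?_⟩ ?_ ?_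
  · rw [sub_zero, abs_of_nonneg ht0]
    linarith
  · rintro n X Y ⟨rfl, hX⟩
    have hln : 0 < l ^ n := by positivity
    set τ := (t - X) / l ^ n with hτ
    have htX : t - X = τ * l ^ n := by rw [hτ, div_mul_cancel₀ _ hln.ne']
    have hτ' : |τ| ≤ 5 / 8 := by
      rw [htX, abs_mul, abs_of_pos hln] at hX
      exact le_of_mul_le_mul_right hX hln
    have hr := abs_le.1 (abs_sub_round ((q : ℝ) * τ))
    have hτ2 := abs_le.1 hτ'
    refine ⟨round ((q : ℝ) * τ), 0, ?_, by simpa using by omega, by simp, ?_⟩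
    · have : |(round ((q : ℝ) * τ) : ℝ)| < q := by
        rw [abs_lt]
        constructor <;> nlinarith
      exact_mod_cast this
    · have : t - (X + round ((q : ℝ) * τ) / q * l ^ n) =
          (q * τ - round ((q : ℝ) * τ)) / q * l ^ n := by
        rw [← sub_sub, htX]
        field_simp
      rw [this, abs_mul, abs_of_pos hln, pow_succ', ← mul_assoc]
      refine mul_le_mul_of_nonneg_right ?_ hln.le
      rw [abs_div, abs_of_pos (by linarith : (0 : ℝ) < q), div_le_iff₀ (by linarith)]
      exact (abs_sub_round _).trans (by linarith)
  · rintro n X Y ⟨rfl, hX⟩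
    have hln : l ^ n ≤ 1 := pow_le_one₀ h0.le h1.le
    have h := abs_le.1 hX
    have : X ^ 2 + 0 ^ 2 - t ^ 2 = -((t - X) * (t + X)) := by ring
    rw [this, abs_neg, abs_mul, mul_comm 2]
    have h2 : |t + X| ≤ 2 := abs_le.2 ⟨by linarith, by linarith⟩
    have hln' : 0 < l ^ n := by positivity
    exact mul_le_mul (by linarith) h2 (abs_nonneg _) hln'.le

theorem exists_greedy_step {x μ s : ℝ} (hx : 0 ≤ x) (hμ : 0 < μ) (hs : x ^ 2 ≤ s) :
    ∃ z : ℤ, 0 ≤ z ∧ (x + z * μ) ^ 2 ≤ s ∧ s < (x + z * μ + μ) ^ 2 := by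
  have hs0 : 0 ≤ s := (sq_nonneg x).trans hs
  have hxs : x ≤ √s := Real.le_sqrt_of_sq_le hs
  have hz : (0 : ℤ) ≤ ⌊(√s - x) / μ⌋ := Int.floor_nonneg.2 (div_nonneg (by linarith) hμ.le)
  have hz' : (0 : ℝ) ≤ (⌊(√s - x) / μ⌋ : ℤ) := by exact_mod_cast hz
  have h1 := (le_div_iff₀ hμ).1 (Int.floor_le ((√s - x) / μ))
  have h2 := (div_lt_iff₀ hμ).1 (Int.lt_floor_add_one ((√s - x) / μ))
  refine ⟨_, hz, ?_, ?_⟩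
  · calc _ ≤ √s ^ 2 := by
          gcongr
          linarith
      _ = s := Real.sq_sqrt hs0
  · calc s = √s ^ 2 := (Real.sq_sqrt hs0).symm
      _ < _ := by
          gcongr
          linarith

/-- The remainder bounds kept by the greedy digit choice at level `n`, where `h = q ^ (-1/2)`. -/
def GreedyBounds (h t l : ℝ) (n : ℕ) (X Y : ℝ) : Prop :=
  1 / 9 ≤ X ∧ 2 * h ^ 2 ≤ Y ∧ t ^ 2 - X ^ 2 ≤ 2 * h ^ 2 ∧ 0 ≤ t ^ 2 - X ^ 2 - Y ^ 2 ∧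
    t ^ 2 - X ^ 2 - Y ^ 2 ≤ l ^ n / 8

theorem exists_greedyBounds_one {q : ℕ} {l t h : ℝ} (hh0 : 0 < h)
    (hh1 : h ≤ 1 / 40) (hhq : h ^ 2 * q = 1) (hl : 40 * h ≤ l * q)
    (ht0 : 1 / 8 ≤ t) (ht1 : t ≤ 1 / 2) :
    ∃ z w : ℤ, |z| < q ∧ |w| < q ∧ GreedyBounds h t l 1 (z * h ^ 2) (w * h ^ 2) := by
  have hq0 : (0 : ℝ) < q := by
    by_contra hc
    nlinarith [sq_nonneg h]
  have hq1 : (1600 : ℝ) ≤ q := by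
    have : h ^ 2 ≤ 1 / 1600 := by nlinarith
    nlinarith
  have hz1 := Int.floor_le (t * q)
  have hz2 := Int.lt_floor_add_one (t * q)
  -- The `- 1` keeps `t - X ≥ h²`, so `t² - X²` has order `h²` and `Y` has order `h`; the floor
  -- alone could leave `Y = 0`.
  set z : ℤ := ⌊t * q⌋ - 1 with hz
  have hzc : (z : ℝ) = (⌊t * q⌋ : ℤ) - 1 := by rw [hz]; push_cast; ring
  set X : ℝ := z * h ^ 2 with hXdef
  have hth : t * q * h ^ 2 = t := by linear_combination t * hhq
  have hX1 : X ≤ t - h ^ 2 := by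
    calc X ≤ (t * q - 1) * h ^ 2 := by
          rw [hXdef]
          gcongr
          linarith
      _ = t - h ^ 2 := by linear_combination hth
  have hX2 : t - 2 * h ^ 2 ≤ X := by
    calc t - 2 * h ^ 2 = (t * q - 2) * h ^ 2 := by linear_combination -hth
      _ ≤ X := by
          rw [hXdef]
          gcongr
          linarith
  have hh2 : h ^ 2 ≤ h / 40 := by nlinarith
  have hs1 : t ^ 2 - X ^ 2 ≤ 2 * h ^ 2 := by
    have h3 : (t - X) * (t + X) ≤ 2 * h ^ 2 * 1 :=
      mul_le_mul (by linarith) (by linarith [sq_nonneg h]) (by linarith) (by positivity)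
    linarith
  have hs2 : h ^ 2 / 9 ≤ t ^ 2 - X ^ 2 := by
    have h3 : h ^ 2 * (1 / 9) ≤ (t - X) * (t + X) :=
      mul_le_mul (by linarith) (by linarith) (by norm_num) (by nlinarith [sq_nonneg h])
    linarith
  obtain ⟨w, hw0, hw1, hw2⟩ := exists_greedy_step (x := 0) (μ := h ^ 2) (s := t ^ 2 - X ^ 2)
    le_rfl (by positivity) (by nlinarith [sq_nonneg h])
  rw [zero_add] at hw1 hw2
  set Y : ℝ := w * h ^ 2 with hYdef
  have hY0 : 0 ≤ Y := mul_nonneg (by exact_mod_cast hw0) (by positivity)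
  have hYu : Y ≤ 2 * h := abs_le_of_sq_le_sq' (by nlinarith) (by linarith) |>.2
  have hYl : h / 3 ≤ Y + h ^ 2 :=
    abs_le_of_sq_le_sq' (by nlinarith) (by positivity) |>.2
  refine ⟨z, w, ?_, ?_, ?_⟩
  · have : |(z : ℝ)| < q := abs_lt.2 ⟨by nlinarith, by nlinarith⟩
    exact_mod_cast this
  · have hw0' : (0 : ℝ) ≤ w := by exact_mod_cast hw0
    have : |(w : ℝ)| < q := by
      rw [abs_of_nonneg hw0']
      by_contra hc
      have : (q : ℝ) * h ^ 2 ≤ Y := mul_le_mul_of_nonneg_right (not_lt.1 hc) (by positivity)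
      nlinarith
    exact_mod_cast this
  · refine ⟨by nlinarith, by nlinarith, hs1, by linarith, ?_⟩
    have hlh : 40 * h * h ^ 2 ≤ l := by
      calc 40 * h * h ^ 2 ≤ l * q * h ^ 2 := by gcongr
        _ = l := by linear_combination l * hhq
    have hY3 : Y * h ^ 2 ≤ 2 * h * h ^ 2 := by gcongr
    have hh4 : h ^ 2 * h ^ 2 ≤ h * h ^ 2 := by
      gcongr
      linarith
    rw [← hXdef, ← hYdef, pow_one]
    have e : (Y + h ^ 2) ^ 2 = Y ^ 2 + 2 * (Y * h ^ 2) + h ^ 2 * h ^ 2 := by ring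
    have : 0 < h * h ^ 2 := by positivity
    linarith

/-- `X`, then `Y`, is increased as far as the circle allows, in steps `μ = l^n / q`. The lower
bounds on `X` and `Y` keep the new digits below `q`; the bound `Y ≤ 2h`, from `t² - X² ≤ 2h²`, makes
the last adjustment fine enough. -/
theorem exists_greedyBounds_succ {q : ℕ} {l t h : ℝ} (h0 : 0 < l) (hh0 : 0 < h)
    (hh1 : h ≤ 1 / 40) (hhq : h ^ 2 * q = 1) (hl1 : l * q ≤ 1)
    (hl : 40 * h ≤ l * q) (ht0 : 1 / 8 ≤ t) (ht1 : t ≤ 1 / 2) {n : ℕ} {X Y : ℝ}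
    (hXY : GreedyBounds h t l n X Y) : ∃ z w : ℤ, |z| < q ∧ |w| < q ∧
      GreedyBounds h t l (n + 1) (X + z * (l ^ n * h ^ 2)) (Y + w * (l ^ n * h ^ 2)) := by
  obtain ⟨hX, hY, hXt, hR0, hR⟩ := hXY
  have hq0 : (0 : ℝ) < q := by
    by_contra hc
    nlinarith [sq_nonneg h]
  have hq1 : (1600 : ℝ) ≤ q := by
    have : h ^ 2 ≤ 1 / 1600 := by nlinarith
    nlinarith
  have hlt1 : l < 1 := by nlinarith
  have hln : 0 < l ^ n := by positivity
  obtain ⟨μ, hμ⟩ : ∃ μ, μ = l ^ n * h ^ 2 := ⟨_, rfl⟩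
  have hμ0 : 0 < μ := by rw [hμ]; positivity
  have hμq : μ * q = l ^ n := by rw [hμ]; linear_combination l ^ n * hhq
  have hμh : μ ≤ h := by
    have h5 : l ^ n ≤ 1 := pow_le_one₀ h0.le hlt1.le
    have h6 : l ^ n * h ^ 2 ≤ 1 * h ^ 2 := by gcongr
    nlinarith
  have hY0 : 0 < Y := lt_of_lt_of_le (by positivity) hY
  obtain ⟨z, hz0, hz1, hz2⟩ := exists_greedy_step (x := X) (μ := μ) (s := t ^ 2 - Y ^ 2)
    (by linarith) hμ0 (by linarith)
  have hz0' : (0 : ℝ) ≤ z := by exact_mod_cast hz0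
  have hzμ : 0 ≤ z * μ := by positivity
  set X' := X + z * μ with hX'
  have hX't : X' ≤ t := abs_le_of_sq_le_sq' (by nlinarith) (by linarith) |>.2
  obtain ⟨w, hw0, hw1, hw2⟩ := exists_greedy_step (x := Y) (μ := μ) (s := t ^ 2 - X' ^ 2)
    hY0.le hμ0 (by linarith)
  have hw0' : (0 : ℝ) ≤ w := by exact_mod_cast hw0
  have hwμ : 0 ≤ w * μ := by positivity
  set Y' := Y + w * μ with hY'
  have hXX : X ^ 2 ≤ X' ^ 2 := by gcongr; linarith
  have hY'u : Y' ≤ 2 * h := abs_le_of_sq_le_sq' (by nlinarith) (by linarith) |>.2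
  refine ⟨z, w, ?_, ?_, ?_⟩
  · have h7 : 2 * X * (z * μ) ≤ μ * q / 8 := by
      have e : X' ^ 2 = X ^ 2 + 2 * X * (z * μ) + (z * μ) ^ 2 := by rw [hX']; ring
      linarith [sq_nonneg (z * μ)]
    have h8 : 2 / 9 * (z * μ) ≤ 2 * X * (z * μ) := by gcongr; linarith
    have : |(z : ℝ)| < q := by
      rw [abs_of_nonneg hz0']
      by_contra hc
      have : (q : ℝ) * μ ≤ z * μ := mul_le_mul_of_nonneg_right (not_lt.1 hc) hμ0.le
      have : 0 < μ * q := by positivity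
      linarith
    exact_mod_cast this
  · have h7 : 2 * Y * (w * μ) < 2 * μ := by
      have : X' * μ ≤ 1 / 2 * μ := by gcongr; linarith
      have : μ * μ ≤ 1 * μ := by gcongr; linarith
      have e : Y' ^ 2 = Y ^ 2 + 2 * Y * (w * μ) + (w * μ) ^ 2 := by rw [hY']; ring
      have e' : (X' + μ) ^ 2 = X' ^ 2 + 2 * (X' * μ) + μ * μ := by ring
      linarith [sq_nonneg (w * μ)]
    have h8 : Y * w < 1 := by
      by_contra hc
      have := mul_le_mul_of_nonneg_right (not_lt.1 hc) hμ0.le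
      linarith
    have : |(w : ℝ)| < q := by
      rw [abs_of_nonneg hw0']
      by_contra hc
      have : 2 * h ^ 2 * q ≤ Y * w := mul_le_mul hY (not_lt.1 hc) hq0.le hY0.le
      linarith
    exact_mod_cast this
  · rw [← hμ]
    refine ⟨by linarith, by linarith, by linarith, by linarith, ?_⟩
    -- The new remainder is below `2 Y' μ + μ² ≤ 5 h μ`, and `40 h ≤ l q` turns this into `l^(n+1) /
    -- 8`.
    have h7 : Y' * μ ≤ 2 * h * μ := by gcongr
    have h8 : μ * μ ≤ h * μ := by gcongr
    have h9 : 40 * h * μ ≤ l ^ (n + 1) := by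
      calc 40 * h * μ ≤ l * q * μ := by gcongr
        _ = l ^ (n + 1) := by rw [pow_succ, ← hμq]; ring
    have e : (Y' + μ) ^ 2 = Y' ^ 2 + 2 * (Y' * μ) + μ * μ := by ring
    have : 0 ≤ h * μ := by positivity
    linarith

theorem exists_sq_add_sq_of_large {q : ℕ} {l t h : ℝ} (h0 : 0 < l) (hh0 : 0 < h)
    (hh1 : h ≤ 1 / 40) (hhq : h ^ 2 * q = 1) (hl1 : l * q ≤ 1) (hl : 40 * h ≤ l * q)
    (ht0 : 1 / 8 ≤ t) (ht1 : t ≤ 1 / 2) :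
    ∃ a ∈ signedDigitSums q l, ∃ b ∈ signedDigitSums q l, a ^ 2 + b ^ 2 = t ^ 2 := by
  have hq0 : (0 : ℝ) < q := by
    by_contra hc
    nlinarith [sq_nonneg h]
  have hinv : (1 : ℝ) / q = h ^ 2 := by rw [← hhq, mul_div_assoc, div_self hq0.ne', mul_one]
  have hq1 : (1600 : ℝ) ≤ q := by
    have : h ^ 2 ≤ 1 / 1600 := by nlinarith
    nlinarith
  have hlt1 : l < 1 := by nlinarith
  refine exists_signedDigitSums_sq_add_sq h0.le hlt1
    -- Level 0 is kept apart, since the empty sums violate `1/9 ≤ X`.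
    (fun n X Y => (n = 0 ∧ X = 0 ∧ Y = 0) ∨ (n ≠ 0 ∧ GreedyBounds h t l n X Y))
    (Or.inl ⟨rfl, rfl, rfl⟩) ?_ ?_
  · rintro n X Y (⟨rfl, rfl, rfl⟩ | ⟨hn, hXY⟩)
    · obtain ⟨z, w, hz, hw, hb⟩ := exists_greedyBounds_one hh0 hh1 hhq hl ht0 ht1
      refine ⟨z, w, hz, hw, Or.inr ⟨by simp, ?_⟩⟩
      convert! hb using 1 <;> rw [← hinv] <;> ring
    · obtain ⟨z, w, hz, hw, hb⟩ := exists_greedyBounds_succ h0 hh0 hh1 hhq hl1 hl ht0 ht1 hXY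
      refine ⟨z, w, hz, hw, Or.inr ⟨by simp, ?_⟩⟩
      convert! hb using 1 <;> rw [← hinv] <;> ring
  · rintro n X Y (⟨rfl, rfl, rfl⟩ | ⟨hn, hX, hY, hXt, hR0, hR⟩)
    · rw [abs_le]
      constructor <;> nlinarith
    · have hln : 0 < l ^ n := by positivity
      rw [abs_le]
      constructor <;> linarith

/-! ### Hausdorff dimension -/

/-- The cell of the word `w` in the stage of order `n`. -/
def falconerCell (d q : ℕ) (σ : ℝ) :
    (n : ℕ) → (Fin n → Fin d → Fin q) → Set (EuclideanSpace ℝ (Fin d))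
  | 0, _ => unitCube d
  | n + 1, w => affineCopy (gridPoint (w 0)) ((q : ℝ) ^ (-σ)) (falconerCell d q σ n (Fin.tail w))

theorem falconerStage_subset_iUnion_falconerCell (d q : ℕ) (σ : ℝ) (n : ℕ) :
    falconerStage d q σ n ⊆ ⋃ w, falconerCell d q σ n w := by
  induction n with
  | zero => exact fun x hx => Set.mem_iUnion.2 ⟨Fin.elim0, hx⟩
  | succ n ih =>
    refine Set.iUnion_subset fun p => ?_
    rintro _ ⟨y, hy, rfl⟩
    obtain ⟨w, hw⟩ := Set.mem_iUnion.1 (ih hy)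
    refine Set.mem_iUnion.2 ⟨(Fin.cons p w : Fin (n + 1) → Fin d → Fin q), y, ?_, ?_⟩
    · simpa using hw
    · simp

theorem ediam_affineCopy_le {d : ℕ} (x : EuclideanSpace ℝ (Fin d)) {u : ℝ} (hu : 0 ≤ u)
    (A : Set (EuclideanSpace ℝ (Fin d))) :
    Metric.ediam (affineCopy x u A) ≤ ENNReal.ofReal u * Metric.ediam A := by
  have h : LipschitzWith u.toNNReal fun y : EuclideanSpace ℝ (Fin d) => x + u • y := by
    refine LipschitzWith.of_dist_le_mul fun y z => ?_
    rw [dist_add_left, dist_smul₀, Real.norm_of_nonneg hu, Real.coe_toNNReal _ hu]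
  exact h.ediam_image_le A

theorem ediam_falconerCell_le {d q : ℕ} {σ : ℝ} (n : ℕ) (w : Fin n → Fin d → Fin q) :
    Metric.ediam (falconerCell d q σ n w) ≤
      ENNReal.ofReal ((q : ℝ) ^ (-σ)) ^ n * Metric.ediam (unitCube d) := by
  induction n with
  | zero => simp [falconerCell]
  | succ n ih =>
    refine (ediam_affineCopy_le _ (by positivity) _).trans ?_
    rw [pow_succ', mul_assoc]
    gcongr
    exact ih _

/-- Stage `n` has `q^(dn)` cells of diameter at most a constant times `l^n`, and `q^d l^s = 1`
because `σ s = d`. -/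
theorem dimH_falconerSet_le {d q : ℕ} {σ s : ℝ} (hq : 0 < q) (h1 : (q : ℝ) ^ (-σ) < 1)
    (hs : 0 ≤ s) (hσ : σ * s = d) : dimH (falconerSet d q σ) ≤ ENNReal.ofReal s := by
  have hq' : (0 : ℝ) < q := by exact_mod_cast hq
  set L := ENNReal.ofReal ((q : ℝ) ^ (-σ)) with hL
  set D := Metric.ediam (unitCube d) with hD
  have hDtop : D ≠ ⊤ := (isCompact_unitCube d).isBounded.ediam_ne_top
  have hL1 : L < 1 := ENNReal.ofReal_lt_one.2 h1
  have hLs : (q : ENNReal) ^ d * L ^ s = 1 := by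
    rw [hL, ENNReal.ofReal_rpow_of_pos (by positivity), ← Real.rpow_mul hq'.le, neg_mul, hσ,
      Real.rpow_neg hq'.le, Real.rpow_natCast, ENNReal.ofReal_inv_of_pos (by positivity),
      ENNReal.ofReal_pow hq'.le, ENNReal.ofReal_natCast]
    exact ENNReal.mul_inv_cancel (by simp [hq.ne']) (by simp)
  have hLim : Filter.Tendsto (fun n : ℕ => L ^ (n + 1) * D) Filter.atTop (nhds 0) := by
    have := ENNReal.Tendsto.mul_const (b := D) ((Filter.tendsto_add_atTop_iff_nat 1).2
      (ENNReal.tendsto_pow_atTop_nhds_zero_of_lt_one hL1)) (Or.inr hDtop)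
    simpa using this
  refine dimH_le_of_hausdorffMeasure_ne_top (d := s.toNNReal) ?_
  rw [Real.coe_toNNReal _ hs]
  refine ne_top_of_le_ne_top (b := D ^ s) (by simp [hDtop, hs]) ?_
  refine (MeasureTheory.Measure.hausdorffMeasure_le_liminf_sum s _ _ hLim
    (fun n w => falconerCell d q σ (n + 1) w)
    (Filter.Eventually.of_forall fun n w => ediam_falconerCell_le (n + 1) w)
    (Filter.Eventually.of_forall fun n => (Set.iInter_subset _ n).trans
      (falconerStage_subset_iUnion_falconerCell d q σ (n + 1)))).trans ?_
  refine Filter.liminf_le_of_frequently_le' (Filter.Frequently.of_forall fun n => ?_)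
  calc ∑ w, Metric.ediam (falconerCell d q σ (n + 1) w) ^ s
      ≤ ∑ _w : Fin (n + 1) → Fin d → Fin q, (L ^ (n + 1) * D) ^ s := by
        gcongr with w
        exact ediam_falconerCell_le (n + 1) w
    _ = ((q : ENNReal) ^ d * L ^ s) ^ (n + 1) * D ^ s := by
        rw [ENNReal.mul_rpow_of_nonneg _ _ hs, Finset.sum_const, nsmul_eq_mul, ← mul_assoc, mul_pow]
        congr 2
        · simp
        · rw [← ENNReal.rpow_natCast, ← ENNReal.rpow_natCast, ← ENNReal.rpow_mul,
            ← ENNReal.rpow_mul, mul_comm]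
    _ = D ^ s := by rw [hLs, one_pow, one_mul]

/-- Reading the same digits in base `q` is Hölder of exponent `1/σ`: agreement up to place `n` gives
`q^(-n) = (l^n)^(1/σ)`. -/
theorem abs_ofDigits_sub_le_rpow {q : ℕ} {σ : ℝ} (hq : 0 < q) (hσ : 0 < σ)
    (h1 : (q : ℝ) ^ (-σ) < 1) (hl : (q : ℝ) ^ (-σ) < 1 / q) (a b : ℕ → Fin q) :
    |Real.ofDigits a - Real.ofDigits b| ≤ (1 / q - (q : ℝ) ^ (-σ)) ^ (-σ⁻¹) *
      |cantorSum ((q : ℝ) ^ (-σ)) a - cantorSum ((q : ℝ) ^ (-σ)) b| ^ σ⁻¹ := by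
  by_cases hab : a = b
  · subst hab
    simp only [sub_self, abs_zero]
    rw [Real.zero_rpow (inv_ne_zero hσ.ne'), mul_zero]
  have hq' : (0 : ℝ) < q := by exact_mod_cast hq
  have hg : 0 < 1 / q - (q : ℝ) ^ (-σ) := sub_pos.2 hl
  have hex : ∃ n, a n ≠ b n := Function.ne_iff.1 hab
  classical
  have hmin : ∀ k < Nat.find hex, a k = b k := fun k hk => not_not.1 (Nat.find_min hex hk)
  have hle := le_abs_cantorSum_sub (by positivity) h1 hl.le _ a b hmin (Nat.find_spec hex)
  refine (Real.abs_ofDigits_sub_ofDigits_le hmin).trans ?_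
  calc ((q : ℝ) ^ Nat.find hex)⁻¹
      = (1 / q - (q : ℝ) ^ (-σ)) ^ (-σ⁻¹) *
        ((1 / q - (q : ℝ) ^ (-σ)) * ((q : ℝ) ^ (-σ)) ^ Nat.find hex) ^ σ⁻¹ := by
        rw [Real.mul_rpow hg.le (by positivity), ← mul_assoc, ← Real.rpow_add hg, neg_add_cancel,
          Real.rpow_zero, one_mul, ← Real.rpow_natCast, ← Real.rpow_natCast,
          ← Real.rpow_mul hq'.le, ← Real.rpow_mul hq'.le, ← Real.rpow_neg hq'.le]
        congr 1
        field_simp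
    _ ≤ _ := by gcongr

/-- Base-`q` reading maps `C^d` onto the cube, and a Hölder map of exponent `1/σ` multiplies
dimension by at most `σ`. -/
theorem le_dimH_falconerSet {d q : ℕ} {σ s : ℝ} (hq : 1 < q) (hσ : 0 < σ)
    (h1 : (q : ℝ) ^ (-σ) < 1) (hl : (q : ℝ) ^ (-σ) < 1 / q) (hσs : σ * s = d) :
    ENNReal.ofReal s ≤ dimH (falconerSet d q σ) := by
  have : Nonempty (Fin q) := ⟨⟨0, by omega⟩⟩
  set π : (Fin d → ℕ → Fin q) → EuclideanSpace ℝ (Fin d) := fun a =>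
    WithLp.toLp 2 (fun i => cantorSum ((q : ℝ) ^ (-σ)) (a i)) with hπ
  set f : EuclideanSpace ℝ (Fin d) → Fin d → ℝ := fun x i =>
    Real.ofDigits (Function.invFun π x i) with hf
  set c : ℝ := (1 / q - (q : ℝ) ^ (-σ)) ^ (-σ⁻¹) with hc
  have hc0 : 0 ≤ c := Real.rpow_nonneg (sub_pos.2 hl).le _
  have hinv : ∀ x ∈ Set.range π, π (Function.invFun π x) = x := fun x hx => Function.invFun_eq hx
  have hholder : HolderOnWith c.toNNReal (σ⁻¹).toNNReal f (Set.range π) := by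
    intro x hx y hy
    refine edist_pi_le_iff.2 fun i => ?_
    have h := abs_ofDigits_sub_le_rpow (by omega) hσ h1 hl (Function.invFun π x i)
      (Function.invFun π y i)
    have hx' : cantorSum ((q : ℝ) ^ (-σ)) (Function.invFun π x i) = x i :=
      congrArg (fun v : EuclideanSpace ℝ (Fin d) => v i) (hinv x hx)
    have hy' : cantorSum ((q : ℝ) ^ (-σ)) (Function.invFun π y i) = y i :=
      congrArg (fun v : EuclideanSpace ℝ (Fin d) => v i) (hinv y hy)
    rw [hx', hy'] at h
    have hxy : |x i - y i| ≤ dist x y := by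
      rw [dist_eq_norm]
      exact PiLp.norm_apply_le (x - y) i
    rw [edist_dist, edist_dist, Real.dist_eq, Real.coe_toNNReal _ (by positivity),
      ENNReal.ofReal_rpow_of_nonneg dist_nonneg (by positivity)]
    change _ ≤ ENNReal.ofReal c * _
    rw [← ENNReal.ofReal_mul hc0]
    refine ENNReal.ofReal_le_ofReal (h.trans ?_)
    gcongr
  have hsurj : Set.Icc 0 1 ⊆ f '' Set.range π := by
    intro y hy
    choose a ha using fun i => Real.ofDigits_SurjOn hq (⟨hy.1 i, hy.2 i⟩ : y i ∈ Set.Icc (0:ℝ) 1)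
    refine ⟨π a, ⟨a, rfl⟩, funext fun i => ?_⟩
    -- The chosen preimage may differ from `a`, but the two sums agree, so the Hölder bound forces
    -- equal base-`q` values.
    have h := abs_ofDigits_sub_le_rpow (by omega) hσ h1 hl (Function.invFun π (π a) i) (a i)
    have hx' : cantorSum ((q : ℝ) ^ (-σ)) (Function.invFun π (π a) i) = _ :=
      congrArg (fun v : EuclideanSpace ℝ (Fin d) => v i) (hinv (π a) ⟨a, rfl⟩)
    rw [hx', hπ] at h
    simp only [sub_self, abs_zero] at h
    rw [Real.zero_rpow (inv_ne_zero hσ.ne'), mul_zero, abs_nonpos_iff, (ha i).2] at h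
    exact sub_eq_zero.1 h
  have hcube : dimH (Set.Icc (0 : Fin d → ℝ) 1) = d := by
    have hint : (interior (Set.Icc (0 : Fin d → ℝ) 1)).Nonempty := by
      rw [← Set.pi_univ_Icc, interior_pi_set Set.finite_univ]
      exact ⟨fun _ => 1 / 2, fun i _ => by simp [interior_Icc]; norm_num⟩
    rw [Real.dimH_of_nonempty_interior hint, Module.finrank_fin_fun]
  have hdim := (hcube.symm.le.trans (dimH_mono hsurj)).trans
    (hholder.dimH_image_le (Real.toNNReal_pos.2 (by positivity)))
  have hsub : Set.range π ⊆ falconerSet d q σ := by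
    rintro _ ⟨a, rfl⟩
    exact cantorSum_mem_falconerSet h1 hl.le a
  refine le_trans ?_ (dimH_mono hsub)
  have hσ0 : ((σ⁻¹).toNNReal : ENNReal) ≠ 0 := by simpa using hσ
  rw [ENNReal.le_div_iff_mul_le (Or.inl hσ0) (Or.inl ENNReal.coe_ne_top)] at hdim
  refine le_trans (le_of_eq ?_) hdim
  change _ = _ * ENNReal.ofReal σ⁻¹
  rw [← ENNReal.ofReal_natCast d, ← ENNReal.ofReal_mul (by positivity), ← hσs]
  congr 1
  field_simp

theorem dimH_falconerSet {d q : ℕ} {σ s : ℝ} (hq : 1 < q) (hσ : 0 < σ)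
    (h1 : (q : ℝ) ^ (-σ) < 1) (hl : (q : ℝ) ^ (-σ) < 1 / q) (hs : 0 ≤ s) (hσs : σ * s = d) :
    dimH (falconerSet d q σ) = ENNReal.ofReal s :=
  le_antisymm (dimH_falconerSet_le (by omega) h1 hs hσs) (le_dimH_falconerSet hq hσ h1 hl hσs)

/-! ### The Steinhaus property of the union -/

theorem Icc_subset_signedDigitSums_radii {q : ℕ} {σ t : ℝ} (hσ1 : 1 < σ) (hσ2 : σ ≤ 1 + 1 / 88)
    (hq : 4 < (q : ℝ) ^ σ) (hq1 : 1 < q) (ht0 : 1 / 8 ≤ t) (ht1 : t ≤ 1 / 2) :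
    ∃ a ∈ signedDigitSums q ((q : ℝ) ^ (-σ)), ∃ b ∈ signedDigitSums q ((q : ℝ) ^ (-σ)),
      a ^ 2 + b ^ 2 = t ^ 2 := by
  have hq1' : (1 : ℝ) < q := by exact_mod_cast hq1
  have hq0 : (0 : ℝ) < q := by linarith
  have hl0 : 0 < (q : ℝ) ^ (-σ) := by positivity
  have hl1 : (q : ℝ) ^ (-σ) < 1 := Real.rpow_lt_one_of_one_lt_of_neg hq1' (by linarith)
  have hlq : (q : ℝ) ^ (-σ) * q = (q : ℝ) ^ (1 - σ) := by
    rw [← Real.rpow_add_one hq0.ne']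
    ring_nf
  -- The threshold lies between `40^4`, needed for `40 q^(-1/2) ≤ q^(-1/4)`, and `(5/4)^88`, needed
  -- for `q^(1/88) ≤ 5/4`.
  by_cases hbig : q < 2 ^ 22
  · have hδ : (q : ℝ) ^ (σ - 1) ≤ 5 / 4 := by
      calc (q : ℝ) ^ (σ - 1) ≤ (q : ℝ) ^ (1 / 88 : ℝ) :=
            Real.rpow_le_rpow_of_exponent_le hq1'.le (by linarith)
        _ ≤ ((5 / 4 : ℝ) ^ (88 : ℕ)) ^ (1 / 88 : ℝ) := by
            gcongr
            calc (q : ℝ) ≤ 2 ^ 22 := by exact_mod_cast hbig.le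
              _ ≤ _ := by norm_num
        _ = 5 / 4 := by
            rw [← Real.rpow_natCast, ← Real.rpow_mul (by norm_num)]
            norm_num
    have hq4 : 4 ≤ q := by
      have h : (q : ℝ) ^ σ = q * (q : ℝ) ^ (σ - 1) := by
        rw [mul_comm, ← Real.rpow_add_one hq0.ne']
        ring_nf
      have h2 : (q : ℝ) * (q : ℝ) ^ (σ - 1) ≤ q * (5 / 4) := by gcongr
      have h3 : (3 : ℝ) < q := by linarith
      exact_mod_cast h3
    refine exists_sq_add_sq_of_ratio_large hq4 hl0 hl1 ?_ (by linarith) ht1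
    rw [hlq, ← neg_sub σ 1, Real.rpow_neg hq0.le, le_inv_comm₀ (by norm_num) (by positivity)]
    linarith
  · have hl1q : (q : ℝ) ^ (-σ) * q ≤ 1 := by
      rw [hlq]
      exact Real.rpow_le_one_of_one_le_of_nonpos hq1'.le (by linarith)
    have h40 : 40 * (q : ℝ) ^ (-(1 / 2) : ℝ) ≤ (q : ℝ) ^ (-σ) * q := by
      calc 40 * (q : ℝ) ^ (-(1 / 2) : ℝ)
          = ((40 : ℝ) ^ (4 : ℕ)) ^ (1 / 4 : ℝ) * (q : ℝ) ^ (-(1 / 2) : ℝ) := by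
            rw [← Real.rpow_natCast, ← Real.rpow_mul (by norm_num)]
            norm_num
        _ ≤ (q : ℝ) ^ (1 / 4 : ℝ) * (q : ℝ) ^ (-(1 / 2) : ℝ) := by
            gcongr
            calc (40 : ℝ) ^ 4 ≤ (2 : ℝ) ^ 22 := by norm_num
              _ ≤ (q : ℝ) := by exact_mod_cast not_lt.1 hbig
        _ = (q : ℝ) ^ (-(1 / 4) : ℝ) := by
            rw [← Real.rpow_add hq0]
            norm_num
        _ ≤ _ := by
            rw [hlq]
            exact Real.rpow_le_rpow_of_exponent_le hq1'.le (by linarith)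
    refine exists_sq_add_sq_of_large hl0 (by positivity) (by linarith) ?_ hl1q h40 ht0 ht1
    rw [← Real.rpow_natCast, ← Real.rpow_mul hq0.le, ← Real.rpow_add_one hq0.ne']
    norm_num

theorem mul_mem_distanceSet_affineCopy {d : ℕ} {A : Set (EuclideanSpace ℝ (Fin d))} {t u : ℝ}
    (ht : t ∈ distanceSet A) (hu : 0 ≤ u) (x : EuclideanSpace ℝ (Fin d)) :
    u * t ∈ distanceSet (affineCopy x u A) := by
  obtain ⟨y, hy, z, hz, rfl⟩ := ht
  refine ⟨_, ⟨y, hy, rfl⟩, _, ⟨z, hz, rfl⟩, ?_⟩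
  rw [dist_add_left, dist_smul₀, Real.norm_of_nonneg hu]

theorem pow_mul_mem_signedDigitSums {q : ℕ} {l x : ℝ} (hx : x ∈ signedDigitSums q l) (n : ℕ) :
    l ^ n * x ∈ signedDigitSums q l := by
  induction n with
  | zero => simpa using hx
  | succ n ih =>
    rw [pow_succ', mul_assoc]
    exact mul_mem_signedDigitSums ih

theorem hasSteinhausProperty_iUnion_affineCopy {d q m : ℕ} {σ : ℝ} (hd : 2 ≤ d) (hσ1 : 1 < σ)
    (hσ2 : σ ≤ 1 + 1 / 88) (hq1 : 1 < q) (hq : 4 < (q : ℝ) ^ σ) (hm : (q : ℝ) ^ σ ≤ 4 ^ (m + 1))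
    (x : Fin (m + 1) → EuclideanSpace ℝ (Fin d)) :
    HasSteinhausProperty (⋃ k, affineCopy (x k) ((1 / 4) ^ (k : ℕ)) (falconerSet d q σ)) := by
  have hq1' : (1 : ℝ) < q := by exact_mod_cast hq1
  have hq0 : (0 : ℝ) < q := by linarith
  set l : ℝ := (q : ℝ) ^ (-σ) with hl
  have hl0 : 0 < l := by positivity
  have hl1 : l < 1 := Real.rpow_lt_one_of_one_lt_of_neg hq1' (by linarith)
  have hlq : l ≤ 1 / q := by
    rw [one_div, ← Real.rpow_neg_one]
    exact Real.rpow_le_rpow_of_exponent_le hq1'.le (by linarith)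
  have hml : (1 / 4 : ℝ) ^ (m + 1) ≤ l := by
    rw [hl, Real.rpow_neg hq0.le, one_div, inv_pow]
    gcongr
  have hmem : ∀ (k : Fin (m + 1)) (t : ℝ), t ∈ distanceSet (falconerSet d q σ) →
      (1 / 4) ^ (k : ℕ) * t ∈
        distanceSet (⋃ k, affineCopy (x k) ((1 / 4) ^ (k : ℕ)) (falconerSet d q σ)) := by
    intro k t ht
    obtain ⟨y, hy, z, hz, h⟩ := mul_mem_distanceSet_affineCopy ht
      (by positivity : (0 : ℝ) ≤ (1 / 4) ^ (k : ℕ)) (x k)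
    exact ⟨y, Set.mem_iUnion.2 ⟨k, hy⟩, z, Set.mem_iUnion.2 ⟨k, hz⟩, h⟩
  refine ⟨1 / 2, by norm_num, fun t ht => ?_⟩
  rcases ht.1.eq_or_lt with rfl | ht0
  · have h := zero_mem_signedDigitSums (q := q) (by omega) l
    have := hmem 0 0 (mem_distanceSet_falconerSet hd (by omega) hl1 hlq le_rfl h h (by simp))
    simpa using this
  -- Here `t = 4^(-k) · l^n · ρ` with `ρ` in the window: `D` absorbs `l^n`, the copy of index `k`
  -- supplies `4^(-k)`, and `k ≤ m` since `τ > l ≥ 4^(-(m+1))`.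
  obtain ⟨n, hn1, hn2⟩ := exists_nat_pow_near_of_lt_one (x := 2 * t) (by linarith)
    (by linarith [ht.2]) hl0 hl1
  have hln : 0 < l ^ n := by positivity
  obtain ⟨τ, hτ⟩ : ∃ τ, τ = 2 * t / l ^ n := ⟨_, rfl⟩
  have htτ : 2 * t = τ * l ^ n := by rw [hτ, div_mul_cancel₀ _ hln.ne']
  have hτl : l < τ := by rwa [hτ, lt_div_iff₀ hln, ← pow_succ']
  have hτ1 : τ ≤ 1 := by rwa [hτ, div_le_one hln]
  obtain ⟨k, hk1, hk2⟩ := exists_nat_pow_near_of_lt_one (x := τ) (y := 1 / 4) (by linarith) hτ1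
    (by norm_num) (by norm_num)
  have hkm : k < m + 1 := by
    by_contra hc
    have : (1 / 4 : ℝ) ^ k ≤ (1 / 4) ^ (m + 1) :=
      pow_le_pow_of_le_one (by norm_num) (by norm_num) (not_lt.1 hc)
    linarith
  have h4k : (0 : ℝ) < (1 / 4) ^ k := by positivity
  obtain ⟨a, ha, b, hb, hab⟩ := Icc_subset_signedDigitSums_radii (t := τ / (1 / 4) ^ k / 2) hσ1 hσ2
    hq hq1 (by
      have : 1 / 4 ≤ τ / (1 / 4) ^ k := by
        rw [le_div_iff₀ h4k, ← pow_succ']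
        exact hk1.le
      linarith) (by
      have := (div_le_one h4k).2 hk2
      linarith)
  have hτ0 : 0 < τ := by linarith
  have := hmem ⟨k, hkm⟩ (l ^ n * (τ / (1 / 4) ^ k / 2)) (mem_distanceSet_falconerSet hd (by omega)
    hl1 hlq (by positivity) (pow_mul_mem_signedDigitSums ha n) (pow_mul_mem_signedDigitSums hb n)
    (by linear_combination (l ^ n) ^ 2 * hab))
  convert! this using 1
  field_simp
  linarith

/-! ### Assembly -/

theorem exists_disjoint_affineCopies {d q m : ℕ} {s : ℝ} (hd : 2 ≤ d) (hs1 : (d : ℝ) - 1 / 88 < s)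
    (hs2 : s < d) (hq : 4 < (q : ℝ) ^ ((d : ℝ) / s))
    (hm : (q : ℝ) ^ ((d : ℝ) / s) ≤ 4 ^ (m + 1)) :
    ∃ (x : Fin (m + 1) → EuclideanSpace ℝ (Fin d)) (u : Fin (m + 1) → ℝ)
      (K : Set (EuclideanSpace ℝ (Fin d))),
      (∀ k, 0 < u k) ∧
      Pairwise (fun j k =>
        Disjoint (affineCopy (x j) (u j) (falconerSet d q ((d : ℝ) / s)))
          (affineCopy (x k) (u k) (falconerSet d q ((d : ℝ) / s)))) ∧
      K = ⋃ k, affineCopy (x k) (u k) (falconerSet d q ((d : ℝ) / s)) ∧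
      IsCompact K ∧ IsTotallyDisconnected K ∧ dimH K = ENNReal.ofReal s ∧
      HasSteinhausProperty K := by
  have hd' : (2 : ℝ) ≤ d := by exact_mod_cast hd
  have hs0 : 1 < s := by linarith
  set σ := (d : ℝ) / s with hσ
  have hσs : σ * s = d := div_mul_cancel₀ _ (by linarith)
  have hσ1 : 1 < σ := (one_lt_div (by linarith)).2 hs2
  -- `σ - 1 = (d - s) / s`, and `s > 1`.
  have hσ2 : σ ≤ 1 + 1 / 88 := by
    rw [hσ, div_le_iff₀ (by linarith)]
    linarith
  have hq1 : 1 < q := by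
    by_contra hc
    have : (q : ℝ) ^ σ ≤ 1 :=
      Real.rpow_le_one (by positivity) (by exact_mod_cast not_lt.1 hc) (by linarith)
    linarith
  have hq1' : (1 : ℝ) < q := by exact_mod_cast hq1
  have hl1 : (q : ℝ) ^ (-σ) < 1 := Real.rpow_lt_one_of_one_lt_of_neg hq1' (by linarith)
  have hlq : (q : ℝ) ^ (-σ) < 1 / q := by
    rw [one_div, ← Real.rpow_neg_one]
    exact Real.rpow_lt_rpow_of_exponent_lt hq1' (by linarith)
  have hql : q * (q : ℝ) ^ (-σ) < 1 := by
    rw [mul_comm]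
    exact (lt_div_iff₀ (by linarith)).1 hlq
  -- The copy of index `k` lies in the cube `[2k, 2k + 1]^d`.
  let x : Fin (m + 1) → EuclideanSpace ℝ (Fin d) := fun k => WithLp.toLp 2 fun _ => 2 * (k : ℕ)
  refine ⟨x, fun k => (1 / 4) ^ (k : ℕ), _, fun k => by positivity, ?_, rfl,
    isCompact_iUnion fun k => isCompact_affineCopy _ _ (isCompact_falconerSet d q σ),
    isTotallyDisconnected_iUnion_affineCopy hql _ _, ?_,
    hasSteinhausProperty_iUnion_affineCopy hd hσ1 hσ2 hq1 hq hm x⟩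
  · have hcoord : ∀ (k : Fin (m + 1)), ∀ y ∈ affineCopy (x k) ((1 / 4) ^ (k : ℕ))
        (falconerSet d q σ), 2 * ((k : ℕ) : ℝ) ≤ y ⟨0, by omega⟩ ∧
          y ⟨0, by omega⟩ ≤ 2 * ((k : ℕ) : ℝ) + 1 := by
      rintro k _ ⟨z, hz, rfl⟩
      obtain ⟨hz0, hz1⟩ := falconerSet_subset_unitCube hlq.le hz ⟨0, by omega⟩
      have hu1 : (1 / 4 : ℝ) ^ (k : ℕ) ≤ 1 := pow_le_one₀ (by norm_num) (by norm_num)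
      have hu0 : (0 : ℝ) ≤ (1 / 4 : ℝ) ^ (k : ℕ) := by positivity
      simp only [x, PiLp.add_apply, PiLp.smul_apply, smul_eq_mul]
      exact ⟨by linarith [mul_nonneg hu0 hz0], by linarith [mul_le_one₀ hu1 hz0 hz1]⟩
    have key : ∀ j k : Fin (m + 1), j < k →
        Disjoint (affineCopy (x j) ((1 / 4) ^ (j : ℕ)) (falconerSet d q σ))
          (affineCopy (x k) ((1 / 4) ^ (k : ℕ)) (falconerSet d q σ)) := by
      intro j k hjk
      refine Set.disjoint_left.2 fun y hyj hyk => ?_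
      have h1 := (hcoord j y hyj).2
      have h2 := (hcoord k y hyk).1
      have h3 : ((j : ℕ) : ℝ) + 1 ≤ (k : ℕ) := by exact_mod_cast hjk
      linarith
    intro j k hjk
    rcases lt_or_gt_of_ne hjk with h | h
    · exact key j k h
    · exact (key k j h).symm
  · rw [dimH_iUnion]
    simp only [dimH_affineCopy _ (pow_ne_zero _ (by norm_num : (1 / 4 : ℝ) ≠ 0)),
      dimH_falconerSet hq1 (by linarith) hl1 hlq (by linarith) hσs, iSup_const]

theorem corollary1p7 (d : ℕ) (hd : 2 ≤ d) :
    ∃ ε r : ℝ, 0 < ε ∧ 1 < r ∧ ∀ s : ℝ, (d : ℝ) - ε < s → s < d →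
      (∃ K : Set (EuclideanSpace ℝ (Fin d)),
        IsCompact K ∧ IsTotallyDisconnected K ∧ dimH K = ENNReal.ofReal s ∧
          HasSteinhausProperty K) ∧
      ∀ q m : ℕ, r < (q : ℝ) ^ ((d : ℝ) / s) →
        IsGreatest {k : ℕ | r ^ k < (q : ℝ) ^ ((d : ℝ) / s)} m →
        ∃ (x : Fin (m + 1) → EuclideanSpace ℝ (Fin d)) (u : Fin (m + 1) → ℝ)
          (K : Set (EuclideanSpace ℝ (Fin d))),
          (∀ k, 0 < u k) ∧
          Pairwise (fun j k =>
            Disjoint (affineCopy (x j) (u j) (falconerSet d q ((d : ℝ) / s)))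
              (affineCopy (x k) (u k) (falconerSet d q ((d : ℝ) / s)))) ∧
          K = ⋃ k, affineCopy (x k) (u k) (falconerSet d q ((d : ℝ) / s)) ∧
          IsCompact K ∧ IsTotallyDisconnected K ∧ dimH K = ENNReal.ofReal s ∧
          HasSteinhausProperty K := by

  refine ⟨1 / 88, 4, by norm_num, by norm_num, fun s hs1 hs2 => ⟨?_, ?_⟩⟩
  · have hd' : (2 : ℝ) ≤ d := by exact_mod_cast hd
    have h1 : 1 < (d : ℝ) / s := (one_lt_div (by linarith)).2 hs2
    have h2 : (d : ℝ) / s ≤ 2 := by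
      rw [div_le_iff₀ (by linarith)]
      linarith
    -- Two copies with `q = 4` serve, since `1 < d/s ≤ 2` gives `4 < 4^(d/s) ≤ 4²`.
    obtain ⟨_, _, K, _, _, _, hK⟩ := exists_disjoint_affineCopies (q := 4) (m := 1) hd hs1 hs2
      (by
        push_cast
        simpa using Real.rpow_lt_rpow_of_exponent_lt (by norm_num : (1 : ℝ) < 4) h1)
      (by
        push_cast
        simpa using Real.rpow_le_rpow_of_exponent_le (by norm_num : (1 : ℝ) ≤ 4) h2)
    exact ⟨K, hK⟩
  · intro q m hq hm
    refine exists_disjoint_affineCopies hd hs1 hs2 hq (not_lt.1 fun h => ?_)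
    have : m + 1 ≤ m := hm.2 h
    omega
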